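/- Let $c\in\mathbb{C}$, let $p_c(z)=z^2+c$, let $K_c$ be the set of points of $\mathbb{C}$ with bounded forward $p_c$-orbit, and let $J_c=\partial K_c$. Assume that $K_c$ is connected and that $J_c$ is locally connected (this is so, for instance, when the critical point $0$ is periodic under $p_c$). Let $\gamma_c:\mathbb{R}/\mathbb{Z}\to J_c$ be the Carathéodory loop of $p_c$: $\gamma_c(\theta)=\overline\psi(e^{2\pi i\theta})$, where $\overline\psi$ is the continuous extension to $\{|w|\ge 1\}$ of the conformal isomorphism $\psi:\{|w|>1\}\to\mathbb{C}\setminus K_c$ with $\psi(w)/w\to 1$ as $w\to\infty$ and $\psi(w^2)=p_c(\psi(w))$. A Fatou component of $p_c$ is a connected component of the complement of $J_c$ in the Riemann sphere; it is periodic if some iterate $p_c^{\circ k}$, $k>0$, maps it onto itself, and strictly preperiodic if it is not periodic but some iterated image of it is. If $\vartheta\in\mathbb{R}/\mathbb{Z}$ is periodic under the angle doubling map $\theta\mapsto 2\theta$, then $\gamma_c(\vartheta)$ does not belong to the boundary of any strictly preperiodic Fatou component of $p_c$. -/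

import Mathlib

open Set Filter Topology

/-- The quadratic polynomial `p_c(z) = z ^ 2 + c`. -/
def quadPoly (c : ℂ) (z : ℂ) : ℂ := z ^ 2 + c

/-- The filled Julia set `K_c`: the points of `ℂ` whose forward `p_c`-orbit is bounded. -/
def filledJulia (c : ℂ) : Set ℂ :=
  {z | Bornology.IsBounded (Set.range fun n : ℕ => (quadPoly c)^[n] z)}

/-- The Julia set `J_c`: the boundary of the filled Julia set. -/
def juliaSet (c : ℂ) : Set ℂ := frontier (filledJulia c)

/-- The extension of `p_c` to the Riemann sphere `ℂ ∪ {∞}`, fixing `∞`. -/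
def spherePoly (c : ℂ) : OnePoint ℂ → OnePoint ℂ := OnePoint.map (quadPoly c)

/-- The Fatou set of `p_c`: the complement of the Julia set in the Riemann sphere. -/
def fatouSet (c : ℂ) : Set (OnePoint ℂ) := ((fun z : ℂ => (z : OnePoint ℂ)) '' juliaSet c)ᶜ

/-- A Fatou component of `p_c`: a connected component of the Fatou set. -/
def IsFatouComponent (c : ℂ) (U : Set (OnePoint ℂ)) : Prop :=
  ∃ x ∈ fatouSet c, U = connectedComponentIn (fatouSet c) x

/-- `U` is mapped to itself by some positive iterate of `p_c`. -/
def IsPeriodicSet (c : ℂ) (U : Set (OnePoint ℂ)) : Prop :=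
  ∃ k : ℕ, 0 < k ∧ (spherePoly c)^[k] '' U = U

/-- A strictly preperiodic Fatou component: some iterated image of it is periodic, but it is not
periodic itself. -/
def IsStrictlyPreperiodicFatouComponent (c : ℂ) (U : Set (OnePoint ℂ)) : Prop :=
  IsFatouComponent c U ∧ ¬ IsPeriodicSet c U ∧
    ∃ n : ℕ, IsPeriodicSet c ((spherePoly c)^[n] '' U)

/-- `ψ`, restricted to `{w : 1 < ‖w‖}`, is the Böttcher parametrization of the basin of infinity:
the conformal isomorphism onto the complement of `K_c`, tangent to the identity at infinity, that
conjugates `w ↦ w ^ 2` with `p_c`. -/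
structure IsBoettcherParam (c : ℂ) (ψ : ℂ → ℂ) : Prop where
  differentiableOn : DifferentiableOn ℂ ψ {w | 1 < ‖w‖}
  bijOn : Set.BijOn ψ {w | 1 < ‖w‖} (filledJulia c)ᶜ
  conj : ∀ w : ℂ, 1 < ‖w‖ → ψ (w ^ 2) = quadPoly c (ψ w)
  tangent : Tendsto (fun w : ℂ => ψ w / w) (Bornology.cobounded ℂ) (𝓝 1)

/-- `γ : ℝ/ℤ → ℂ` is the Carathéodory loop of `p_c`: it gives the boundary values (at
`exp (2πiθ)`) of the continuous extension of the Böttcher parametrization to the unit circle. -/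
def IsCaratheodoryLoop (c : ℂ) (γ : UnitAddCircle → ℂ) : Prop :=
  ∃ ψ : ℂ → ℂ, IsBoettcherParam c ψ ∧
    ∀ θ : UnitAddCircle,
      Tendsto ψ (𝓝[{w : ℂ | 1 < ‖w‖}] (AddCircle.toCircle θ : ℂ)) (𝓝 (γ θ))

/-- The angle doubling map on `ℝ/ℤ`. -/
def angleDoubling (θ : UnitAddCircle) : UnitAddCircle := 2 • θ

/-! Suppose `p = γ ϑ` lies on the boundary of a nonperiodic component; it is a component `C` of the
interior of `K_c`, since the basin of infinity is periodic. The fibre of `γ` over `p` is compact,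
and an iterate of doubling maps it injectively into itself: the corresponding iterate of `p_c` fixes
`p`, and is injective near `p` because a superattracting point is not in `J_c`. By expansion the
fibre is finite (`UnitAddCircle.finite_of_injOn_nsmul`), so some `f = p_c^N` fixes `p` and `2 ^ N`
fixes every angle of the fibre.

Since `C` is not periodic, `V = f(C)` is a different component, and it also touches `p`. Take `x ≠
p` on the boundary of `C`, close to `p`, and write `x = γ (θ + t)` with `θ` in the fibre and `t`
small. Then `f x = γ (θ + 2 ^ N t)` lies in the closure of `V`, and the arc `L` of points `γ (θ + s
t)`, `1 ≤ s ≤ 2 ^ N`, joins the two closures inside `J_c` without meeting `p`.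

Two components cannot be joined both at `p` and away from `p`. For `u ∈ C` and `v ∈ V`, external
rays give a continuous logarithm of `(γ θ - u) / (γ θ - v)` on the circle. It descends to `J_c` if
it agrees at angles with a common landing point `q`, and this holds when `u` and `v` lie in a
connected subset of `K_c \ {q}`: use `C ∪ {p} ∪ V` for `q ≠ p` and `C ∪ L ∪ V` for `q = p`
(`IsBoettcherParam.exists_log_of_touching`). But `J_c` separates `u` from `v`, so Eilenberg's
criterion forbids such a logarithm (`not_exists_log_of_separated`). -/

/-! ### Continuous logarithms and Eilenberg's criterion -/

/-- Homotopy lifting through the covering `exp`, starting from the logarithm `0` of `1`. -/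
theorem exists_continuous_log_of_homotopy {A : Type*} [TopologicalSpace A]
    (F : unitInterval × A → ℂ) (hF : Continuous F) (hne : ∀ x, F x ≠ 0)
    (h0 : ∀ a, F (0, a) = 1) :
    ∃ G : unitInterval × A → ℂ, Continuous G ∧ (∀ x, Complex.exp (G x) = F x) := by
  let H : C(unitInterval × A, {z : ℂ // z ≠ 0}) :=
    ⟨fun x => ⟨F x, hne x⟩, hF.subtype_mk _⟩
  have hH : ∀ a, H (0, a) = (fun z : ℂ ↦ (⟨_, z.exp_ne_zero⟩ : {z : ℂ // z ≠ 0}))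
      ((0 : C(A, ℂ)) a) := by
    intro a
    apply Subtype.ext
    simp [H, h0]
  refine ⟨Complex.isCoveringMap_exp.liftHomotopy H 0 hH, ContinuousMap.continuous _, fun x => ?_⟩
  have := congrFun (Complex.isCoveringMap_exp.liftHomotopy_lifts H 0 hH) x
  exact congrArg Subtype.val this

/-- The fibres of `exp` are discrete, so a continuous logarithm of a constant cannot jump on a
connected set. -/
theorem IsPreconnected.eq_of_exp_eq {X : Type*} [TopologicalSpace X] {S : Set X}
    (hS : IsPreconnected S) {g : X → ℂ} (hg : ContinuousOn g S) {c : ℂ}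
    (he : ∀ x ∈ S, Complex.exp (g x) = c) {x y : X} (hx : x ∈ S) (hy : y ∈ S) :
    g x = g y := by
  refine Complex.isCoveringMap_exp.isSeparatedMap.constOn_of_comp
    Complex.isCoveringMap_exp.isLocalHomeomorph.isLocallyInjective hS hg ?_ hx hy
  intro a ha b hb
  apply Subtype.ext
  simp [he a ha, he b hb]

/-- A continuous nonvanishing function on the plane cannot coincide with `z - u` near infinity
when it has no zeros at all. -/
theorem exists_zero_of_eq_sub_near_infty (G : ℂ → ℂ) (hG : Continuous G) (u : ℂ) (R : ℝ)
    (hR : ∀ z, R ≤ ‖z - u‖ → G z = z - u) : ∃ z, G z = 0 := by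
  by_contra! hne
  -- The radial contraction of the plane gives a global logarithm of `G / G 0`.
  obtain ⟨L, hL, hexp⟩ := exists_continuous_log_of_homotopy (A := ℂ)
    (fun x => G ((x.1 : ℝ) * x.2) / G 0) (by fun_prop)
    (fun x => div_ne_zero (hne _) (hne _)) (fun a => by simp [hne 0])
  set ρ : ℝ := max R 1 with hρ
  have hρ1 : (0 : ℝ) < ρ := lt_of_lt_of_le one_pos (le_max_right _ _)
  -- On a large circle about `u` this difference is a logarithm of a constant, hence constant; yet
  -- over one turn `L` returns to its value while `t * I` gains `2πi`.
  let g : ℝ → ℂ := fun t => L (1, u + ρ * Complex.exp (t * Complex.I)) - t * Complex.I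
  have hg : Continuous g := by
    simp only [g]
    fun_prop
  have hge : ∀ t ∈ (univ : Set ℝ), Complex.exp (g t) = ρ / G 0 := by
    intro t _
    have hG' : G (u + ρ * Complex.exp (t * Complex.I)) = ρ * Complex.exp (t * Complex.I) := by
      rw [hR]
      · ring
      · rw [add_sub_cancel_left, norm_mul, Complex.norm_exp_ofReal_mul_I, mul_one, Complex.norm_real,
          Real.norm_of_nonneg hρ1.le]
        exact le_max_left _ _
    simp only [g]
    rw [Complex.exp_sub, hexp]
    simp only [Set.Icc.coe_one, Complex.ofReal_one, one_mul, hG']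
    field_simp [Complex.exp_ne_zero]
  have h := isPreconnected_univ.eq_of_exp_eq hg.continuousOn hge (mem_univ 0)
    (mem_univ (2 * Real.pi))
  simp only [g] at h
  have h2 : Complex.exp (((2 * Real.pi : ℝ) : ℂ) * Complex.I) = 1 := by
    push_cast
    exact Complex.exp_two_pi_mul_I
  rw [h2] at h
  simp at h
  exact Complex.two_pi_I_ne_zero (by linear_combination h)

/-- One half of Eilenberg's criterion: points separated by a compact set `J` admit no continuous
logarithm of `(z - u) / (z - v)` on `J`. -/
theorem not_exists_log_of_separated {J D : Set ℂ} (hJ : IsCompact J)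
    (hDb : Bornology.IsBounded D) (hDJ : frontier D ⊆ J) {u v : ℂ} (hu : u ∈ D)
    (hvD : v ∉ D) (hvJ : v ∉ J) (h : C(J, ℂ))
    (hh : ∀ z : J, Complex.exp (h z) = ((z : ℂ) - u) / ((z : ℂ) - v)) : False := by
  classical
  obtain ⟨k, hk⟩ := h.exists_restrict_eq hJ.isClosed
  have hkJ : ∀ z (hz : z ∈ J), k z = h ⟨z, hz⟩ := by
    intro z hz
    rw [← hk]; rfl
  -- The two formulas agree on the frontier of `D`, where `k` is the given logarithm. Each has its
  -- only possible zero (`v`, resp. `u`) outside the region where it is used.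
  let G : ℂ → ℂ := D.piecewise (fun z => (z - v) * Complex.exp (k z)) (fun z => z - u)
  have hG : Continuous G := by
    apply Continuous.piecewise
    · intro a ha
      rw [hkJ a (hDJ ha), hh]
      have : a - v ≠ 0 := sub_ne_zero.2 (fun e => hvJ (e ▸ hDJ ha))
      field_simp
    · fun_prop
    · fun_prop
  obtain ⟨R, hR⟩ := hDb.subset_ball u
  obtain ⟨z, hz⟩ := exists_zero_of_eq_sub_near_infty G hG u R (by
    intro z hz
    have : z ∉ D := fun hzD => by
      have := hR hzD
      rw [Metric.mem_ball, dist_eq_norm] at this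
      linarith
    simp [G, this])
  by_cases hzD : z ∈ D
  · simp only [G, piecewise_eq_of_mem _ _ _ hzD, mul_eq_zero, Complex.exp_ne_zero, or_false] at hz
    exact hvD (sub_eq_zero.1 hz ▸ hzD)
  · simp only [G, piecewise_eq_of_notMem _ _ _ hzD] at hz
    exact hzD (sub_eq_zero.1 hz ▸ hu)

/-! ### The filled Julia set and its dynamics -/

theorem continuous_quadPoly (c : ℂ) : Continuous (quadPoly c) := by
  unfold quadPoly
  fun_prop

theorem differentiable_quadPoly (c : ℂ) : Differentiable ℂ (quadPoly c) := by
  unfold quadPoly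
  fun_prop

theorem isOpenMap_quadPoly (c : ℂ) : IsOpenMap (quadPoly c) := by
  have hA : AnalyticOnNhd ℂ (quadPoly c) univ :=
    (differentiable_quadPoly c).differentiableOn.analyticOnNhd isOpen_univ
  rcases hA.is_constant_or_isOpen isPreconnected_univ with ⟨w, hw⟩ | h
  · have h0 := hw 0 (mem_univ _)
    have h1 := hw 1 (mem_univ _)
    simp only [quadPoly] at h0 h1
    have := h0.trans h1.symm
    norm_num at this
  · exact fun s hs => h s (subset_univ _) hs

theorem quadPoly_surjective (c : ℂ) : Function.Surjective (quadPoly c) := by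
  intro w
  obtain ⟨z, hz⟩ := IsAlgClosed.exists_pow_nat_eq (w - c) two_pos
  exact ⟨z, by simp [quadPoly, hz]⟩

theorem two_mul_norm_le_norm_quadPoly {c z : ℂ} (hz : ‖c‖ + 2 ≤ ‖z‖) :
    2 * ‖z‖ ≤ ‖quadPoly c z‖ := by
  have h1 : ‖z‖ ^ 2 ≤ ‖quadPoly c z‖ + ‖c‖ := by
    have := norm_sub_le (quadPoly c z) c
    simpa [quadPoly] using this
  nlinarith [norm_nonneg c, norm_nonneg z]

theorem mem_filledJulia_iff_isBounded {c z : ℂ} :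
    z ∈ filledJulia c ↔ Bornology.IsBounded (range fun n : ℕ => (quadPoly c)^[n] z) :=
  Iff.rfl

/-- `‖c‖ + 2` is an escape radius: beyond it the modulus at least doubles at each step. -/
theorem mem_filledJulia_iff {c z : ℂ} :
    z ∈ filledJulia c ↔ ∀ n : ℕ, ‖(quadPoly c)^[n] z‖ ≤ ‖c‖ + 2 := by
  constructor
  · intro h n
    by_contra! hn
    have key : ∀ k : ℕ, 2 ^ k * (‖c‖ + 2) ≤ ‖(quadPoly c)^[k + n] z‖ := by
      intro k
      induction k with
      | zero => simpa using hn.le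
      | succ k ih =>
        rw [Nat.add_right_comm, Function.iterate_succ_apply']
        have h1 : ‖c‖ + 2 ≤ ‖(quadPoly c)^[k + n] z‖ :=
          le_trans (le_mul_of_one_le_left (by positivity) (one_le_pow₀ one_le_two)) ih
        have h2 := two_mul_norm_le_norm_quadPoly h1
        rw [pow_succ]
        linarith
    obtain ⟨M, hM⟩ := isBounded_iff_forall_norm_le.1 (mem_filledJulia_iff_isBounded.1 h)
    obtain ⟨k, hk⟩ := pow_unbounded_of_one_lt M (one_lt_two (α := ℝ))
    have h1 := hM _ ⟨k + n, rfl⟩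
    have h2 := key k
    have h3 : (2 : ℝ) ^ k * 1 ≤ 2 ^ k * (‖c‖ + 2) := by
      gcongr
      linarith [norm_nonneg c]
    linarith
  · intro h
    refine mem_filledJulia_iff_isBounded.2 <| isBounded_iff_forall_norm_le.2 ⟨‖c‖ + 2, ?_⟩
    rintro _ ⟨n, rfl⟩
    exact h n

theorem quadPoly_mem_filledJulia_iff {c z : ℂ} :
    quadPoly c z ∈ filledJulia c ↔ z ∈ filledJulia c := by
  constructor
  · intro h
    refine ((mem_filledJulia_iff_isBounded.1 h).insert z).subset ?_
    rintro _ ⟨n, rfl⟩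
    rcases n with _ | n
    · exact mem_insert _ _
    · exact mem_insert_of_mem _ ⟨n, rfl⟩
  · intro h
    refine (mem_filledJulia_iff_isBounded.1 h).subset ?_
    rintro _ ⟨n, rfl⟩
    exact ⟨n + 1, rfl⟩

theorem isClosed_filledJulia (c : ℂ) : IsClosed (filledJulia c) := by
  have : filledJulia c = ⋂ n : ℕ, {z | ‖(quadPoly c)^[n] z‖ ≤ ‖c‖ + 2} := by
    ext z
    simp [mem_filledJulia_iff]
  rw [this]
  exact isClosed_iInter fun n =>
    isClosed_le ((continuous_quadPoly c).iterate n).norm continuous_const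

theorem isBounded_filledJulia (c : ℂ) : Bornology.IsBounded (filledJulia c) :=
  isBounded_iff_forall_norm_le.2 ⟨‖c‖ + 2, fun _ hz => mem_filledJulia_iff.1 hz 0⟩

theorem isCompact_filledJulia (c : ℂ) : IsCompact (filledJulia c) :=
  Metric.isCompact_of_isClosed_isBounded (isClosed_filledJulia c) (isBounded_filledJulia c)

theorem isClosed_juliaSet (c : ℂ) : IsClosed (juliaSet c) := isClosed_frontier

theorem juliaSet_subset (c : ℂ) : juliaSet c ⊆ filledJulia c :=
  (isClosed_filledJulia c).frontier_subset

theorem isCompact_juliaSet (c : ℂ) : IsCompact (juliaSet c) :=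
  (isCompact_filledJulia c).of_isClosed_subset (isClosed_juliaSet c) (juliaSet_subset c)

theorem mem_juliaSet_iff {c z : ℂ} :
    z ∈ juliaSet c ↔ z ∈ filledJulia c ∧ z ∉ interior (filledJulia c) := by
  rw [juliaSet, (isClosed_filledJulia c).frontier_eq, Set.mem_sdiff]

theorem quadPoly_mem_interior_iff {c z : ℂ} :
    quadPoly c z ∈ interior (filledJulia c) ↔ z ∈ interior (filledJulia c) := by
  have hpre : quadPoly c ⁻¹' filledJulia c = filledJulia c :=
    Set.ext fun _ => quadPoly_mem_filledJulia_iff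
  have := (isOpenMap_quadPoly c).preimage_interior_eq_interior_preimage (continuous_quadPoly c)
    (filledJulia c)
  rw [hpre] at this
  rw [← mem_preimage, this]

theorem mem_filledJulia_of_iterate_isBounded {c z : ℂ} {N : ℕ} (hN : 0 < N)
    (h : Bornology.IsBounded (range fun k : ℕ => ((quadPoly c)^[N])^[k] z)) :
    z ∈ filledJulia c := by
  have hcl : IsCompact (closure (range fun k : ℕ => ((quadPoly c)^[N])^[k] z)) :=
    h.isCompact_closure
  have hb : Bornology.IsBounded (⋃ i ∈ Finset.range N,
      (quadPoly c)^[i] '' closure (range fun k : ℕ => ((quadPoly c)^[N])^[k] z)) :=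
    (Bornology.isBounded_biUnion_finset _).2 fun i _ =>
      (hcl.image ((continuous_quadPoly c).iterate i)).isBounded
  refine hb.subset ?_
  rintro _ ⟨n, rfl⟩
  simp only [mem_iUnion, Finset.mem_range]
  refine ⟨n % N, Nat.mod_lt _ hN, ((quadPoly c)^[N])^[n / N] z, subset_closure ⟨_, rfl⟩, ?_⟩
  rw [← Function.iterate_mul, ← Function.iterate_add_apply, Nat.mod_add_div]

/-- A fixed point of an iterate with vanishing multiplier lies in the interior of `K_c`. -/
theorem deriv_iterate_ne_zero_of_mem_juliaSet {c z : ℂ} {N : ℕ} (hN : 0 < N)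
    (hfix : (quadPoly c)^[N] z = z) (hz : z ∈ juliaSet c) : deriv ((quadPoly c)^[N]) z ≠ 0 := by
  intro h0
  have hd : HasDerivAt ((quadPoly c)^[N]) 0 z := by
    rw [← h0]
    exact ((differentiable_quadPoly c).iterate N z).hasDerivAt
  -- With zero multiplier the iterate halves distances to `z` on a small ball, so orbits stay there.
  have hlo := hd.isLittleO.bound (show (0 : ℝ) < 1 / 2 by norm_num)
  obtain ⟨δ, hδ, hball⟩ := Metric.eventually_nhds_iff_ball.1 hlo
  refine (mem_juliaSet_iff.1 hz).2 (mem_interior.2 ⟨Metric.ball z δ, ?_, Metric.isOpen_ball,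
    Metric.mem_ball_self hδ⟩)
  intro w hw
  apply mem_filledJulia_of_iterate_isBounded hN
  refine (Metric.isBounded_ball (x := z) (r := δ)).subset ?_
  rintro _ ⟨k, rfl⟩
  induction k with
  | zero => exact hw
  | succ k ih =>
    simp only [Function.iterate_succ_apply' ((quadPoly c)^[N])]
    have h1 := hball _ ih
    simp only [hfix, smul_zero, sub_zero] at h1
    rw [Metric.mem_ball, dist_eq_norm] at ih ⊢
    have := norm_nonneg (((quadPoly c)^[N])^[k] w - z)
    linarith

theorem exists_injOn_nhds_of_mem_juliaSet {c z : ℂ} {N : ℕ} (hN : 0 < N)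
    (hfix : (quadPoly c)^[N] z = z) (hz : z ∈ juliaSet c) :
    ∃ s ∈ 𝓝 z, InjOn ((quadPoly c)^[N]) s := by
  have hd : HasStrictDerivAt ((quadPoly c)^[N]) (deriv ((quadPoly c)^[N]) z) z :=
    ((((differentiable_quadPoly c).iterate N).analyticAt z).contDiffAt (n := 1)).hasStrictDerivAt
      (by simp)
  have hne := deriv_iterate_ne_zero_of_mem_juliaSet hN hfix hz
  let e := (hd.hasStrictFDerivAt_equiv hne).toOpenPartialHomeomorph
  refine ⟨e.source, e.open_source.mem_nhds
    (hd.hasStrictFDerivAt_equiv hne).mem_toOpenPartialHomeomorph_source, e.injOn⟩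

/-! ### Boundary values of the Böttcher map -/

section CaratheodoryLoop

variable {c : ℂ} {ψ : ℂ → ℂ} {γ : UnitAddCircle → ℂ}

theorem norm_coe_toCircle (θ : UnitAddCircle) : ‖(AddCircle.toCircle θ : ℂ)‖ = 1 :=
  Circle.norm_coe _

theorem exists_eq_toCircle_inv {x : ℂ} (hx : ‖x‖ = 1) :
    ∃ θ : UnitAddCircle, x = (AddCircle.toCircle θ : ℂ)⁻¹ := by
  obtain ⟨θ, hθ⟩ := (AddCircle.homeomorphCircle (one_ne_zero (α := ℝ))).surjective
    ⟨x⁻¹, mem_sphere_zero_iff_norm.2 (by simp [hx])⟩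
  rw [AddCircle.homeomorphCircle_apply] at hθ
  exact ⟨θ, by rw [hθ]; exact (inv_inv x).symm⟩

theorem tendsto_radial (θ : UnitAddCircle) :
    Tendsto (fun r : ℝ => (r : ℂ) * (AddCircle.toCircle θ : ℂ)) (𝓝[>] 1)
      (𝓝[{w : ℂ | 1 < ‖w‖}] (AddCircle.toCircle θ : ℂ)) := by
  refine tendsto_nhdsWithin_iff.2 ⟨?_, ?_⟩
  · have : Continuous (fun r : ℝ => (r : ℂ) * (AddCircle.toCircle θ : ℂ)) := by fun_prop
    simpa using (this.tendsto 1).mono_left nhdsWithin_le_nhds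
  · filter_upwards [self_mem_nhdsWithin] with r hr
    have hr : (1 : ℝ) < r := hr
    simp [abs_of_pos (one_pos.trans hr), hr, norm_coe_toCircle]

theorem nhdsWithin_toCircle_neBot (θ : UnitAddCircle) :
    (𝓝[{w : ℂ | 1 < ‖w‖}] (AddCircle.toCircle θ : ℂ)).NeBot :=
  (tendsto_radial θ).neBot

/-- In the coordinate `x = 1 / w`, the function `ψ w / w` extends continuously to the closed unit
disc. -/
theorem IsBoettcherParam.exists_disc_extension (hψ : IsBoettcherParam c ψ)
    (hγ : ∀ θ : UnitAddCircle,
      Tendsto ψ (𝓝[{w : ℂ | 1 < ‖w‖}] (AddCircle.toCircle θ : ℂ)) (𝓝 (γ θ))) :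
    ∃ R : ℂ → ℂ, ContinuousOn R (Metric.closedBall 0 1) ∧ R 0 = 1 ∧
      (∀ x, x ≠ 0 → ‖x‖ < 1 → R x = x * ψ x⁻¹) ∧
      ∀ θ : UnitAddCircle, R (AddCircle.toCircle θ : ℂ)⁻¹ =
        (AddCircle.toCircle θ : ℂ)⁻¹ * γ θ := by
  set f : ℂ → ℂ := fun x => x * ψ x⁻¹ with hf
  set A : Set ℂ := Metric.ball 0 1 ∩ {0}ᶜ with hA
  have hopen : IsOpen {w : ℂ | 1 < ‖w‖} := isOpen_lt continuous_const continuous_norm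
  have hmem : ∀ x ∈ A, x⁻¹ ∈ {w : ℂ | 1 < ‖w‖} := by
    rintro x ⟨hx1, hx0⟩
    rw [mem_ball_zero_iff] at hx1
    simpa using (one_lt_inv₀ (norm_pos_iff.2 hx0)).2 hx1
  have hcl : Metric.closedBall (0 : ℂ) 1 ⊆ closure A := by
    rw [← closure_ball (0 : ℂ) one_ne_zero]
    exact closure_minimal ((dense_compl_singleton 0).open_subset_closure_inter
      Metric.isOpen_ball) isClosed_closure
  have h0 : Tendsto f (𝓝[A] 0) (𝓝 1) := by
    have h1 : Tendsto (fun x : ℂ => x⁻¹) (𝓝[A] 0) (Bornology.cobounded ℂ) :=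
      tendsto_inv₀_nhdsNE_zero.mono_left (nhdsWithin_mono _ inter_subset_right)
    refine (hψ.tangent.comp h1).congr fun x => ?_
    simp [hf, mul_comm]
  have h1 : ∀ x ∈ A, ContinuousAt f x := by
    intro x hx
    have h2 : ContinuousAt ψ x⁻¹ :=
      (hψ.differentiableOn.differentiableAt (hopen.mem_nhds (hmem x hx))).continuousAt
    have h3 : ContinuousAt (fun y : ℂ => y⁻¹) x := continuousAt_inv₀ hx.2
    exact continuousAt_id.mul (ContinuousAt.comp (f := fun y : ℂ => y⁻¹) h2 h3)
  have h2 : ∀ θ : UnitAddCircle, Tendsto f (𝓝[A] (AddCircle.toCircle θ : ℂ)⁻¹)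
      (𝓝 ((AddCircle.toCircle θ : ℂ)⁻¹ * γ θ)) := by
    intro θ
    have hne : (AddCircle.toCircle θ : ℂ)⁻¹ ≠ 0 := inv_ne_zero (Circle.coe_ne_zero _)
    refine (tendsto_id.mono_left nhdsWithin_le_nhds).mul ((hγ θ).comp ?_)
    refine tendsto_nhdsWithin_iff.2 ⟨?_, ?_⟩
    · have := (continuousAt_inv₀ hne).tendsto
      rw [inv_inv] at this
      exact this.mono_left nhdsWithin_le_nhds
    · filter_upwards [self_mem_nhdsWithin] with x hx using hmem x hx
  refine ⟨extendFrom A f, continuousOn_extendFrom hcl ?_, ?_, ?_, ?_⟩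
  · intro x hx
    by_cases hx0 : x = 0
    · exact ⟨1, hx0 ▸ h0⟩
    by_cases hx1 : ‖x‖ < 1
    · exact ⟨_, (h1 x ⟨mem_ball_zero_iff.2 hx1, hx0⟩).tendsto.mono_left nhdsWithin_le_nhds⟩
    · have hx2 : ‖x‖ = 1 := le_antisymm (mem_closedBall_zero_iff.1 hx) (not_lt.1 hx1)
      obtain ⟨θ, rfl⟩ := exists_eq_toCircle_inv hx2
      exact ⟨_, h2 θ⟩
  · exact extendFrom_eq (hcl (by simp)) h0
  · intro x hx0 hx1
    exact extendFrom_eq (hcl (by simpa using hx1.le))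
      ((h1 x ⟨mem_ball_zero_iff.2 hx1, hx0⟩).tendsto.mono_left nhdsWithin_le_nhds)
  · intro θ
    exact extendFrom_eq (hcl (by simp [norm_coe_toCircle])) (h2 θ)

theorem IsBoettcherParam.continuous_loop (hψ : IsBoettcherParam c ψ)
    (hγ : ∀ θ : UnitAddCircle,
      Tendsto ψ (𝓝[{w : ℂ | 1 < ‖w‖}] (AddCircle.toCircle θ : ℂ)) (𝓝 (γ θ))) :
    Continuous γ := by
  obtain ⟨R, hR, -, -, h⟩ := hψ.exists_disc_extension hγ
  have hc : Continuous fun θ : UnitAddCircle => (AddCircle.toCircle θ : ℂ) :=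
    continuous_subtype_val.comp AddCircle.continuous_toCircle
  have h1 : Continuous fun θ : UnitAddCircle => R (AddCircle.toCircle θ : ℂ)⁻¹ :=
    hR.comp_continuous (hc.inv₀ fun _ => Circle.coe_ne_zero _) (by simp [norm_coe_toCircle])
  refine (hc.mul h1).congr fun θ => ?_
  change (AddCircle.toCircle θ : ℂ) * R (AddCircle.toCircle θ : ℂ)⁻¹ = γ θ
  rw [h, mul_inv_cancel_left₀ (Circle.coe_ne_zero _)]

theorem IsBoettcherParam.loop_two_nsmul (hψ : IsBoettcherParam c ψ)
    (hγ : ∀ θ : UnitAddCircle,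
      Tendsto ψ (𝓝[{w : ℂ | 1 < ‖w‖}] (AddCircle.toCircle θ : ℂ)) (𝓝 (γ θ)))
    (θ : UnitAddCircle) : γ (2 • θ) = quadPoly c (γ θ) := by
  have hsq : Tendsto (fun w : ℂ => w ^ 2)
      (𝓝[{w : ℂ | 1 < ‖w‖}] (AddCircle.toCircle θ : ℂ))
      (𝓝[{w : ℂ | 1 < ‖w‖}] (AddCircle.toCircle (2 • θ) : ℂ)) := by
    refine tendsto_nhdsWithin_iff.2 ⟨?_, ?_⟩
    · rw [AddCircle.toCircle_nsmul, Circle.coe_pow]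
      exact ((continuous_pow 2).tendsto _).mono_left nhdsWithin_le_nhds
    · filter_upwards [self_mem_nhdsWithin] with w hw
      have hw : 1 < ‖w‖ := hw
      simpa using one_lt_pow₀ hw two_ne_zero
  have h1 := (hγ (2 • θ)).comp hsq
  have h2 := ((continuous_quadPoly c).tendsto _).comp (hγ θ)
  have := nhdsWithin_toCircle_neBot θ
  refine tendsto_nhds_unique (h1.congr' ?_) h2
  filter_upwards [self_mem_nhdsWithin] with w hw using hψ.conj w hw

theorem IsBoettcherParam.loop_two_pow_nsmul (hψ : IsBoettcherParam c ψ)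
    (hγ : ∀ θ : UnitAddCircle,
      Tendsto ψ (𝓝[{w : ℂ | 1 < ‖w‖}] (AddCircle.toCircle θ : ℂ)) (𝓝 (γ θ)))
    (n : ℕ) (θ : UnitAddCircle) : γ ((2 ^ n) • θ) = (quadPoly c)^[n] (γ θ) := by
  induction n with
  | zero => simp
  | succ n ih =>
    rw [Function.iterate_succ_apply', ← ih, ← hψ.loop_two_nsmul hγ, smul_smul, pow_succ']

/-- For surjectivity, a point of `J_c` is a limit of values `ψ (w n)`. Compactness of the closed
disc gives a limit `x` of `1 / w n`, which must lie on the unit circle: `x = 0` would contradict `R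
0 = 1`, and `0 < ‖x‖ < 1` would put the limit outside `K_c`. -/
theorem IsBoettcherParam.range_loop (hψ : IsBoettcherParam c ψ)
    (hγ : ∀ θ : UnitAddCircle,
      Tendsto ψ (𝓝[{w : ℂ | 1 < ‖w‖}] (AddCircle.toCircle θ : ℂ)) (𝓝 (γ θ))) :
    range γ = juliaSet c := by
  apply Subset.antisymm
  · rintro _ ⟨θ, rfl⟩
    rw [juliaSet, frontier_eq_closure_inter_closure]
    constructor
    · apply subset_closure
      refine mem_filledJulia_iff_isBounded.2
        ((isCompact_range (hψ.continuous_loop hγ)).isBounded.subset ?_)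
      rintro _ ⟨n, rfl⟩
      exact ⟨2 ^ n • θ, hψ.loop_two_pow_nsmul hγ n θ⟩
    · have := nhdsWithin_toCircle_neBot θ
      refine mem_closure_of_tendsto (hγ θ) ?_
      filter_upwards [self_mem_nhdsWithin] with w hw using hψ.bijOn.mapsTo hw
  · intro z hz
    obtain ⟨R, hR, hR0, hR1, hRγ⟩ := hψ.exists_disc_extension hγ
    have hz' : z ∈ closure (filledJulia c)ᶜ := by
      rw [juliaSet, frontier_eq_closure_inter_closure] at hz
      exact hz.2
    obtain ⟨s, hs, hsz⟩ := mem_closure_iff_seq_limit.1 hz'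
    choose w hw hws using fun n => hψ.bijOn.surjOn (hs n)
    have hw1 : ∀ n, (1 : ℝ) < ‖w n‖ := hw
    have hlt : ∀ n, ‖(w n)⁻¹‖ < 1 := fun n => by
      rw [norm_inv]
      exact inv_lt_one_of_one_lt₀ (hw1 n)
    have hne : ∀ n, w n ≠ 0 := fun n => norm_pos_iff.1 (one_pos.trans (hw1 n))
    obtain ⟨x, hx, φ, hφ, hlim⟩ := (isCompact_closedBall (0 : ℂ) 1).tendsto_subseq
      (x := fun n => (w n)⁻¹) (fun n => by simpa using (hlt n).le)
    have hRx : R x = x * z := by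
      have h1 : Tendsto (fun n => R (w (φ n))⁻¹) atTop (𝓝 (R x)) :=
        (hR x hx).tendsto.comp (tendsto_nhdsWithin_iff.2 ⟨hlim,
          Eventually.of_forall fun n => by simpa using (hlt (φ n)).le⟩)
      refine tendsto_nhds_unique h1 ((hlim.mul (hsz.comp hφ.tendsto_atTop)).congr fun n => ?_)
      rw [hR1 _ (inv_ne_zero (hne _)) (hlt _), inv_inv, hws]
      rfl
    have hx0 : x ≠ 0 := by
      rintro rfl
      simp [hR0] at hRx
    rcases (mem_closedBall_zero_iff.1 hx).lt_or_eq with hx1 | hx1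
    · exfalso
      rw [hR1 x hx0 hx1] at hRx
      have h1 : (1 : ℝ) < ‖x⁻¹‖ := by
        rw [norm_inv]
        exact (one_lt_inv₀ (norm_pos_iff.2 hx0)).2 hx1
      exact hψ.bijOn.mapsTo h1 (mul_left_cancel₀ hx0 hRx ▸ juliaSet_subset c hz)
    · obtain ⟨θ, rfl⟩ := exists_eq_toCircle_inv hx1
      rw [hRγ] at hRx
      exact ⟨θ, mul_left_cancel₀ hx0 hRx⟩

/-- A continuous choice of the argument of `γ θ - s`, measured along the external ray of angle
`θ`. -/
theorem IsBoettcherParam.exists_log (hψ : IsBoettcherParam c ψ)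
    (hγ : ∀ θ : UnitAddCircle,
      Tendsto ψ (𝓝[{w : ℂ | 1 < ‖w‖}] (AddCircle.toCircle θ : ℂ)) (𝓝 (γ θ))) :
    ∃ G : ℂ × UnitAddCircle → ℂ,
      ContinuousOn G {a | a.1 ∈ filledJulia c ∧ a.1 ≠ γ a.2} ∧
      ∀ s θ, s ∈ filledJulia c → s ≠ γ θ →
        Complex.exp (G (s, θ)) = (AddCircle.toCircle θ : ℂ)⁻¹ * (γ θ - s) := by
  classical
  obtain ⟨R, hR, hR0, hR1, hRγ⟩ := hψ.exists_disc_extension hγ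
  set A : Set (ℂ × UnitAddCircle) := {a | a.1 ∈ filledJulia c ∧ a.1 ≠ γ a.2} with hA
  have hc : Continuous fun θ : UnitAddCircle => (AddCircle.toCircle θ : ℂ)⁻¹ :=
    (continuous_subtype_val.comp AddCircle.continuous_toCircle).inv₀ fun _ => Circle.coe_ne_zero _
  have hX : Continuous fun x : unitInterval × A =>
      ((x.1 : ℝ) : ℂ) * (AddCircle.toCircle (x.2 : ℂ × UnitAddCircle).2 : ℂ)⁻¹ :=
    (Complex.continuous_ofReal.comp (continuous_subtype_val.comp continuous_fst)).mul
      (hc.comp (continuous_snd.comp (continuous_subtype_val.comp continuous_snd)))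
  -- With `x = t / e^{2πiθ}` this is `x (ψ (1 / x) - s)` for `0 < t < 1`. It runs along the ray from
  -- infinity (`t = 0`, value `1`) to its landing point (`t = 1`), and does not vanish because `s ∈
  -- K_c` and `s ≠ γ θ`.
  let F : unitInterval × A → ℂ := fun x =>
    R (((x.1 : ℝ) : ℂ) * (AddCircle.toCircle (x.2 : ℂ × UnitAddCircle).2 : ℂ)⁻¹) -
      ((x.1 : ℝ) : ℂ) * (AddCircle.toCircle (x.2 : ℂ × UnitAddCircle).2 : ℂ)⁻¹ *
        (x.2 : ℂ × UnitAddCircle).1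
  have hF : Continuous F := by
    refine (hR.comp_continuous hX fun x => ?_).sub
      (hX.mul (continuous_fst.comp (continuous_subtype_val.comp continuous_snd)))
    rw [mem_closedBall_zero_iff]
    simpa [abs_of_nonneg x.1.2.1, norm_coe_toCircle] using x.1.2.2
  have hF0 : ∀ x, F x ≠ 0 := by
    rintro ⟨⟨t, ht0, ht1⟩, ⟨⟨s, θ⟩, hs, hsθ⟩⟩ h
    simp only [F] at h hs hsθ
    have he : (AddCircle.toCircle θ : ℂ)⁻¹ ≠ 0 := inv_ne_zero (Circle.coe_ne_zero _)
    rcases ht0.eq_or_lt with rfl | ht0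
    · simp [hR0] at h
    rcases ht1.eq_or_lt with rfl | ht1
    · rw [Complex.ofReal_one, one_mul, hRγ, ← mul_sub, mul_eq_zero] at h
      exact hsθ (sub_eq_zero.1 (h.resolve_left he)).symm
    · have hx0 : (t : ℂ) * (AddCircle.toCircle θ : ℂ)⁻¹ ≠ 0 :=
        mul_ne_zero (Complex.ofReal_ne_zero.2 ht0.ne') he
      have hn : ‖(t : ℂ) * (AddCircle.toCircle θ : ℂ)⁻¹‖ = t := by
        simp [abs_of_pos ht0, norm_coe_toCircle]
      rw [hR1 _ hx0 (by rwa [hn]), ← mul_sub, mul_eq_zero] at h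
      have h1 : (1 : ℝ) < ‖((t : ℂ) * (AddCircle.toCircle θ : ℂ)⁻¹)⁻¹‖ := by
        rw [norm_inv, hn]
        exact (one_lt_inv₀ ht0).2 ht1
      exact hψ.bijOn.mapsTo h1 (sub_eq_zero.1 (h.resolve_left hx0) ▸ hs)
  have hF1 : ∀ a, F (0, a) = 1 := fun a => by simp [F, hR0]
  obtain ⟨G, hG, hexp⟩ := exists_continuous_log_of_homotopy F hF hF0 hF1
  refine ⟨fun a => if h : a ∈ A then G (1, ⟨a, h⟩) else 0, ?_, ?_⟩
  · rw [continuousOn_iff_continuous_domRestrict]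
    have : Continuous fun a : A => G (1, a) := by fun_prop
    refine this.congr fun a => ?_
    simp [Set.domRestrict]
  · intro s θ hs hsθ
    have hmem : (s, θ) ∈ A := ⟨hs, hsθ⟩
    simp only [hmem, dif_pos, hexp, F, Set.Icc.coe_one, Complex.ofReal_one, one_mul, hRγ]
    ring

/-! ### Regions joined in two ways -/

theorem isPreconnected_union_of_inter_closure {X : Type*} [TopologicalSpace X] {U V L : Set X}
    (hU : IsPreconnected U) (hV : IsPreconnected V) (hL : IsPreconnected L)
    (hLU : (L ∩ closure U).Nonempty) (hLV : (L ∩ closure V).Nonempty) :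
    IsPreconnected (U ∪ L ∪ V) := by
  obtain ⟨a, haL, haU⟩ := hLU
  obtain ⟨b, hbL, hbV⟩ := hLV
  have h1 : IsPreconnected (insert a U) :=
    hU.subset_closure (subset_insert _ _) (insert_subset haU subset_closure)
  have h2 : IsPreconnected (insert b V) :=
    hV.subset_closure (subset_insert _ _) (insert_subset hbV subset_closure)
  have h3 := (h1.union a (mem_insert _ _) haL hL).union b (Or.inr hbL) (mem_insert _ _) h2
  convert h3 using 1
  ext x
  simp only [mem_union, mem_insert_iff]
  constructor
  · tauto
  · rintro (((rfl | h) | h) | (rfl | h)) <;> tauto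

/-- If the interior regions `U` and `V` touch at `p` and are also joined by a connected subset
of `J_c` avoiding `p`, then `J_c` does not separate `U` from `V`, in the sense of Eilenberg's
criterion. -/
theorem IsBoettcherParam.exists_log_of_touching (hψ : IsBoettcherParam c ψ)
    (hγ : ∀ θ : UnitAddCircle,
      Tendsto ψ (𝓝[{w : ℂ | 1 < ‖w‖}] (AddCircle.toCircle θ : ℂ)) (𝓝 (γ θ)))
    {U V L : Set ℂ} (hU : IsPreconnected U) (hV : IsPreconnected V) (hL : IsPreconnected L)
    (hUK : U ⊆ interior (filledJulia c)) (hVK : V ⊆ interior (filledJulia c))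
    (hLJ : L ⊆ juliaSet c) {p u v : ℂ} (hp : p ∈ juliaSet c) (hpU : p ∈ closure U)
    (hpV : p ∈ closure V) (hLU : (L ∩ closure U).Nonempty) (hLV : (L ∩ closure V).Nonempty)
    (hpL : p ∉ L) (hu : u ∈ U) (hv : v ∈ V) :
    ∃ h : C(juliaSet c, ℂ), ∀ z, Complex.exp (h z) = ((z : ℂ) - u) / ((z : ℂ) - v) := by
  obtain ⟨G, hG, hexp⟩ := hψ.exists_log hγ
  have hγJ : ∀ θ, γ θ ∈ juliaSet c := fun θ => hψ.range_loop hγ ▸ mem_range_self θ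
  have hint : ∀ w ∈ interior (filledJulia c), ∀ θ, w ≠ γ θ := fun w hw θ e =>
    (mem_juliaSet_iff.1 (hγJ θ)).2 (e ▸ hw)
  have hcγ := hψ.continuous_loop hγ
  -- For two rays landing together, `G (s, θ₁) - G (s, θ₂)` is a logarithm of a constant independent
  -- of `s`. It therefore takes the same value at `u` and `v` once `M` links `U` to `V` away from
  -- the landing point.
  have leaf : ∀ M : Set ℂ, IsPreconnected M → M ⊆ juliaSet c → (M ∩ closure U).Nonempty →
      (M ∩ closure V).Nonempty → ∀ θ₁ θ₂, γ θ₁ = γ θ₂ → γ θ₁ ∉ M →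
      G (u, θ₁) - G (v, θ₁) = G (u, θ₂) - G (v, θ₂) := by
    intro M hM hMJ hMU hMV θ₁ θ₂ h12 hnot
    have hS := isPreconnected_union_of_inter_closure hU hV hM hMU hMV
    have hSK : ∀ s ∈ U ∪ M ∪ V, s ∈ filledJulia c ∧ s ≠ γ θ₁ := by
      rintro s ((hs | hs) | hs)
      · exact ⟨interior_subset (hUK hs), hint s (hUK hs) _⟩
      · exact ⟨juliaSet_subset c (hMJ hs), fun e => hnot (e ▸ hs)⟩
      · exact ⟨interior_subset (hVK hs), hint s (hVK hs) _⟩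
    have key := hS.eq_of_exp_eq (g := fun s => G (s, θ₁) - G (s, θ₂))
      (c := (AddCircle.toCircle θ₁ : ℂ)⁻¹ * (AddCircle.toCircle θ₂ : ℂ)) ?_ ?_
      (Or.inl (Or.inl hu)) (Or.inr hv)
    · linear_combination key
    · refine ContinuousOn.sub ?_ ?_
      · exact hG.comp (by fun_prop) fun s hs => hSK s hs
      · exact hG.comp (by fun_prop) fun s hs => ⟨(hSK s hs).1, h12 ▸ (hSK s hs).2⟩
    · intro s hs
      obtain ⟨h1, h2⟩ := hSK s hs
      rw [Complex.exp_sub, hexp s θ₁ h1 h2, hexp s θ₂ h1 (h12 ▸ h2), ← h12]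
      have h3 : γ θ₁ - s ≠ 0 := sub_ne_zero.2 h2.symm
      have h4 := Circle.coe_ne_zero (AddCircle.toCircle θ₁)
      have h5 := Circle.coe_ne_zero (AddCircle.toCircle θ₂)
      field_simp
  have hfib : ∀ θ₁ θ₂, γ θ₁ = γ θ₂ →
      G (u, θ₁) - G (v, θ₁) = G (u, θ₂) - G (v, θ₂) := by
    intro θ₁ θ₂ h12
    by_cases h : γ θ₁ = p
    · exact leaf L hL hLJ hLU hLV θ₁ θ₂ h12 (h ▸ hpL)
    · exact leaf {p} isPreconnected_singleton (singleton_subset_iff.2 hp) ⟨p, rfl, hpU⟩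
        ⟨p, rfl, hpV⟩ θ₁ θ₂ h12 h
  let q : UnitAddCircle → juliaSet c := fun θ => ⟨γ θ, hγJ θ⟩
  -- `J_c` is the quotient of the circle by the fibres of `γ`, so a function constant on them
  -- descends continuously.
  have hq : Continuous q := hcγ.subtype_mk _
  have hqs : Function.Surjective q := by
    rintro ⟨z, hz⟩
    rw [← hψ.range_loop hγ] at hz
    obtain ⟨θ, hθ⟩ := hz
    exact ⟨θ, Subtype.ext hθ⟩
  have hqq : IsQuotientMap q := hq.isClosedMap.isQuotientMap hq hqs
  let h₀ : UnitAddCircle → ℂ := fun θ => G (u, θ) - G (v, θ)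
  have hh₀ : Continuous h₀ := by
    have aux : ∀ w ∈ interior (filledJulia c), Continuous fun θ => G (w, θ) := fun w hw =>
      hG.comp_continuous (by fun_prop) fun θ => ⟨interior_subset hw, hint w hw θ⟩
    exact (aux u (hUK hu)).sub (aux v (hVK hv))
  have hcomp : (h₀ ∘ Function.surjInv hqs) ∘ q = h₀ := by
    funext θ
    exact hfib _ _ (congrArg Subtype.val (Function.surjInv_eq hqs (q θ)))
  refine ⟨⟨h₀ ∘ Function.surjInv hqs, hqq.continuous_iff.2 (hcomp.symm ▸ hh₀)⟩, fun z => ?_⟩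
  obtain ⟨θ, rfl⟩ := hqs z
  change Complex.exp (((h₀ ∘ Function.surjInv hqs) ∘ q) θ) = (γ θ - u) / (γ θ - v)
  have h5 := Circle.coe_ne_zero (AddCircle.toCircle θ)
  have h6 : γ θ - v ≠ 0 := sub_ne_zero.2 (hint v (hVK hv) θ).symm
  rw [hcomp, Complex.exp_sub, hexp u θ (interior_subset (hUK hu)) (hint u (hUK hu) θ),
    hexp v θ (interior_subset (hVK hv)) (hint v (hVK hv) θ)]
  field_simp

end CaratheodoryLoop

/-! ### Expansion on the circle -/

theorem UnitAddCircle.exists_real_norm_eq (x : UnitAddCircle) :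
    ∃ t : ℝ, (t : UnitAddCircle) = x ∧ |t| = ‖x‖ := by
  obtain ⟨r, rfl⟩ := QuotientAddGroup.mk_surjective x
  refine ⟨r - round r, ?_, UnitAddCircle.norm_eq.symm⟩
  rw [AddCircle.coe_sub]
  have : ((round r : ℝ) : UnitAddCircle) = 0 :=
    (AddCircle.coe_eq_zero_iff 1).2 ⟨round r, by simp⟩
  rw [this, sub_zero]

theorem UnitAddCircle.norm_coe_of_abs_le {t : ℝ} (ht : |t| ≤ 1 / 2) :
    ‖(t : UnitAddCircle)‖ = |t| :=
  (AddCircle.norm_coe_eq_abs_iff 1 one_ne_zero).2 (by simpa using ht)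

theorem UnitAddCircle.norm_nsmul_of_le {M : ℕ} {x : UnitAddCircle}
    (hx : M * ‖x‖ ≤ 1 / 2) : ‖M • x‖ = M * ‖x‖ := by
  obtain ⟨t, rfl, ht⟩ := UnitAddCircle.exists_real_norm_eq x
  rw [← ht] at hx ⊢
  have h : |(M : ℝ) * t| = M * |t| := by rw [abs_mul, Nat.abs_cast]
  rw [← AddCircle.coe_nsmul, nsmul_eq_mul, UnitAddCircle.norm_coe_of_abs_le (h ▸ hx), h]

/-- A compact subset of the circle that is mapped injectively into itself by multiplication by
`M ≥ 2` is finite. -/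
theorem UnitAddCircle.finite_of_injOn_nsmul {M : ℕ} (hM : 2 ≤ M) {Θ : Set UnitAddCircle}
    (hΘ : IsCompact Θ) (hmaps : MapsTo (fun x => M • x) Θ Θ)
    (hinj : InjOn (fun x => M • x) Θ) : Θ.Finite := by
  have hM0 : (0 : ℝ) < M := by
    exact_mod_cast (by lia : 0 < M)
  have hM2 : (2 : ℝ) ≤ M := by exact_mod_cast hM
  set g : UnitAddCircle → UnitAddCircle := fun x => M • x with hg
  obtain ⟨δ, hδ, hδP⟩ : ∃ δ > 0, ∀ x ∈ Θ, ∀ y ∈ Θ, 1 / (2 * M) ≤ dist x y →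
      δ ≤ dist (g x) (g y) := by
    have hP : IsCompact ((Θ ×ˢ Θ) ∩ {q : UnitAddCircle × UnitAddCircle |
        (1 : ℝ) / (2 * M) ≤ dist q.1 q.2}) :=
      (hΘ.prod hΘ).inter_right (isClosed_le continuous_const continuous_dist)
    obtain ⟨δ, hδ, h⟩ := hP.exists_forall_le' (f := fun q => dist (g q.1) (g q.2)) (a := 0)
      (by fun_prop) (by
        rintro ⟨x, y⟩ ⟨⟨hx, hy⟩, hxy⟩
        refine dist_pos.2 fun e => ?_
        have hxy : 1 / (2 * (M : ℝ)) ≤ dist x y := hxy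
        have hxe : x = y := hinj hx hy e
        rw [hxe, dist_self] at hxy
        have : 0 < 1 / (2 * (M : ℝ)) := by positivity
        linarith)
    exact ⟨δ, hδ, fun x hx y hy hxy => h (x, y) ⟨⟨hx, hy⟩, hxy⟩⟩
  -- Distances below `1 / (2 * M)` are multiplied by exactly `M`; larger ones stay at least `δ` by
  -- injectivity and compactness. Hence separation by `η`, once reached, persists.
  set η : ℝ := min δ (1 / (2 * M)) with hη
  have hη0 : 0 < η := lt_min hδ (by positivity)
  have hdist : ∀ x y, dist x y < 1 / (2 * M) → dist (g x) (g y) = M * dist x y := by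
    intro x y hxy
    rw [dist_eq_norm] at hxy
    rw [dist_eq_norm, dist_eq_norm, hg, ← nsmul_sub, UnitAddCircle.norm_nsmul_of_le]
    have := mul_le_mul_of_nonneg_left hxy.le hM0.le
    field_simp at this ⊢
    linarith
  have hstep : ∀ x ∈ Θ, ∀ y ∈ Θ, η ≤ dist x y → η ≤ dist (g x) (g y) := by
    intro x hx y hy hxy
    by_cases h : 1 / (2 * (M : ℝ)) ≤ dist x y
    · exact (min_le_left _ _).trans (hδP x hx y hy h)
    · rw [hdist x y (not_le.1 h)]
      nlinarith [dist_nonneg (x := x) (y := y)]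
  have hgk : ∀ k, MapsTo g^[k] Θ Θ := fun k => hmaps.iterate k
  have hsep : ∀ x ∈ Θ, ∀ y ∈ Θ, x ≠ y → ∀ᶠ k in atTop, η ≤ dist (g^[k] x) (g^[k] y) := by
    intro x hx y hy hxy
    obtain ⟨k₀, hk₀⟩ : ∃ k, η ≤ dist (g^[k] x) (g^[k] y) := by
      by_contra! hlt
      have hgrow : ∀ k, dist (g^[k] x) (g^[k] y) = M ^ k * dist x y := by
        intro k
        induction k with
        | zero => simp
        | succ k ih =>
          rw [Function.iterate_succ_apply', Function.iterate_succ_apply',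
            hdist _ _ ((hlt k).trans_le (min_le_right _ _)), ih]
          ring
      obtain ⟨k, hk⟩ := pow_unbounded_of_one_lt (η / dist x y) (by linarith : (1 : ℝ) < M)
      have h1 := hlt k
      rw [hgrow] at h1
      rw [div_lt_iff₀ (dist_pos.2 hxy)] at hk
      linarith
    filter_upwards [eventually_ge_atTop k₀] with k hk
    induction k, hk using Nat.le_induction with
    | base => exact hk₀
    | succ k _ ih =>
      rw [Function.iterate_succ_apply', Function.iterate_succ_apply']
      exact hstep _ (hgk k hx) _ (hgk k hy) ih
  -- A late iterate makes any finite subset `η`-separated, while a finite cover by balls of radius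
  -- `η / 2` bounds the size of such a set.
  by_contra hinf
  obtain ⟨t, -, htf, ht⟩ := (isCompact_univ (X := UnitAddCircle)).finite_cover_balls
    (half_pos hη0)
  obtain ⟨s, hsΘ, hcard⟩ := Set.Infinite.exists_subset_card_eq hinf (htf.toFinset.card + 1)
  obtain ⟨k, hk⟩ : ∃ k, ∀ x ∈ s, ∀ y ∈ s, x ≠ y → η ≤ dist (g^[k] x) (g^[k] y) := by
    refine Eventually.exists (f := atTop) ?_
    refine (Filter.eventually_all_finset s).2 fun x hx =>
      (Filter.eventually_all_finset s).2 fun y hy => ?_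
    by_cases hxy : x = y
    · exact Eventually.of_forall fun _ h => absurd hxy h
    · exact (hsep x (hsΘ hx) y (hsΘ hy) hxy).mono fun _ h _ => h
  have hcov : ∀ x, ∃ y ∈ t, dist (g^[k] x) y < η / 2 := by
    intro x
    simpa using ht (mem_univ (g^[k] x))
  choose φ hφt hφ using hcov
  obtain ⟨x, hx, y, hy, hne, he⟩ := Finset.exists_ne_map_eq_of_card_lt_of_maps_to
    (s := s) (t := htf.toFinset) (f := φ) (by lia) (fun x _ => by simpa using hφt x)
  have h1 := hk x hx y hy hne
  have h2 := dist_triangle_right (g^[k] x) (g^[k] y) (φ x)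
  have h3 := hφ x
  have h4 := hφ y
  rw [← he] at h4
  linarith

/-- An injective self-map of a finite set has an iterate that fixes every point of it. -/
theorem Set.Finite.exists_iterate_eq_self {α : Type*} {s : Set α} (hs : s.Finite) {g : α → α}
    (hmaps : MapsTo g s s) (hinj : InjOn g s) : ∃ m : ℕ, 0 < m ∧ ∀ x ∈ s, g^[m] x = x := by
  have := hs.to_subtype
  let e : Equiv.Perm s := Equiv.ofBijective (hmaps.restrict g s s)
    (Finite.injective_iff_bijective.1 (hmaps.restrict_inj.2 hinj))
  refine ⟨orderOf e, orderOf_pos e, fun x hx => ?_⟩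
  have h1 : (e ^ orderOf e) ⟨x, hx⟩ = ⟨x, hx⟩ := by rw [pow_orderOf_eq_one]; rfl
  have h2 : ∀ n : ℕ, ((e ^ n) ⟨x, hx⟩ : α) = g^[n] x := by
    intro n
    induction n with
    | zero => rfl
    | succ n ih =>
      rw [pow_succ', Equiv.Perm.mul_apply, Function.iterate_succ_apply', ← ih]
      rfl
  rw [← h2, h1]

/-! ### Rays landing at a periodic point -/

section CaratheodoryLoop

variable {c : ℂ} {ψ : ℂ → ℂ} {γ : UnitAddCircle → ℂ}

theorem IsBoettcherParam.conj_iterate (hψ : IsBoettcherParam c ψ) (n : ℕ) {w : ℂ}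
    (hw : 1 < ‖w‖) : ψ (w ^ 2 ^ n) = (quadPoly c)^[n] (ψ w) := by
  induction n with
  | zero => simp
  | succ n ih =>
    rw [pow_succ, pow_mul, hψ.conj _ (by simpa using one_lt_pow₀ hw (by positivity)), ih,
      Function.iterate_succ_apply']

/-- Iterates fixing a point `p` of `J_c` act injectively on the angles of the rays landing
at `p`. -/
theorem IsBoettcherParam.injOn_fiber (hψ : IsBoettcherParam c ψ)
    (hγ : ∀ θ : UnitAddCircle,
      Tendsto ψ (𝓝[{w : ℂ | 1 < ‖w‖}] (AddCircle.toCircle θ : ℂ)) (𝓝 (γ θ)))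
    {N : ℕ} (hN : 0 < N) {p : ℂ} (hp : p ∈ juliaSet c) (hfix : (quadPoly c)^[N] p = p) :
    InjOn (fun θ : UnitAddCircle => 2 ^ N • θ) (γ ⁻¹' {p}) := by
  intro θ hθ θ' hθ' he
  have hθ : γ θ = p := hθ
  have hθ' : γ θ' = p := hθ'
  obtain ⟨s, hs, hinj⟩ := exists_injOn_nhds_of_mem_juliaSet hN hfix hp
  have h1 := ((hγ θ).comp (tendsto_radial θ)).eventually (hθ.symm ▸ hs)
  have h2 := ((hγ θ').comp (tendsto_radial θ')).eventually (hθ'.symm ▸ hs)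
  obtain ⟨r, hr1, hr2, hr⟩ := (h1.and (h2.and self_mem_nhdsWithin)).exists
  have hr : (1 : ℝ) < r := hr
  have hr0 : (r : ℂ) ≠ 0 := Complex.ofReal_ne_zero.2 (one_pos.trans hr).ne'
  have hn : ∀ τ : UnitAddCircle, 1 < ‖(r : ℂ) * (AddCircle.toCircle τ : ℂ)‖ := fun τ => by
    simpa [abs_of_pos (one_pos.trans hr), norm_coe_toCircle] using hr
  have hpow : ((r : ℂ) * (AddCircle.toCircle θ : ℂ)) ^ 2 ^ N =
      ((r : ℂ) * (AddCircle.toCircle θ' : ℂ)) ^ 2 ^ N := by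
    rw [mul_pow, mul_pow, ← Circle.coe_pow, ← Circle.coe_pow, ← AddCircle.toCircle_nsmul,
      ← AddCircle.toCircle_nsmul]
    simp only at he
    rw [he]
  -- Both ray points at radius `r` are close to `p` and have the same image under the iterate, so
  -- local injectivity identifies them.
  have h3 : ψ ((r : ℂ) * (AddCircle.toCircle θ : ℂ)) =
      ψ ((r : ℂ) * (AddCircle.toCircle θ' : ℂ)) := by
    apply hinj hr1 hr2
    change (quadPoly c)^[N] (ψ ((r : ℂ) * (AddCircle.toCircle θ : ℂ))) =
      (quadPoly c)^[N] (ψ ((r : ℂ) * (AddCircle.toCircle θ' : ℂ)))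
    rw [← hψ.conj_iterate N (hn θ), ← hψ.conj_iterate N (hn θ'), hpow]
  have h4 := mul_left_cancel₀ hr0 (hψ.bijOn.injOn (hn θ) (hn θ') h3)
  exact AddCircle.injective_toCircle one_ne_zero (Subtype.ext h4)

/-- If `γ θ` is periodic, some iterate of `p_c` fixes it as well as each of the rays landing
there, and there are finitely many of these. -/
theorem IsBoettcherParam.exists_fixing_iterate (hψ : IsBoettcherParam c ψ)
    (hγ : ∀ θ : UnitAddCircle,
      Tendsto ψ (𝓝[{w : ℂ | 1 < ‖w‖}] (AddCircle.toCircle θ : ℂ)) (𝓝 (γ θ)))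
    {ϑ : UnitAddCircle} (hϑ : ϑ ∈ Function.periodicPts angleDoubling) :
    (γ ⁻¹' {γ ϑ}).Finite ∧ ∃ N : ℕ, 0 < N ∧ ∀ θ, γ θ = γ ϑ → 2 ^ N • θ = θ := by
  obtain ⟨l, hl, hper⟩ := hϑ
  have hiter : ∀ n, ∀ θ : UnitAddCircle, angleDoubling^[n] θ = 2 ^ n • θ := by
    intro n θ
    induction n with
    | zero => simp
    | succ n ih =>
      rw [Function.iterate_succ_apply', ih, angleDoubling, smul_smul, pow_succ']
  have hper' : 2 ^ l • ϑ = ϑ := hiter l ϑ ▸ hper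
  have hfix : (quadPoly c)^[l] (γ ϑ) = γ ϑ := by
    rw [← hψ.loop_two_pow_nsmul hγ, hper']
  have hp : γ ϑ ∈ juliaSet c := hψ.range_loop hγ ▸ mem_range_self ϑ
  have hmaps : MapsTo (fun θ : UnitAddCircle => 2 ^ l • θ) (γ ⁻¹' {γ ϑ}) (γ ⁻¹' {γ ϑ}) := by
    intro θ hθ
    have hθ : γ θ = γ ϑ := hθ
    change γ (2 ^ l • θ) = γ ϑ
    rw [hψ.loop_two_pow_nsmul hγ, hθ, hfix]
  have hinj := hψ.injOn_fiber hγ hl hp hfix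
  have hcpt : IsCompact (γ ⁻¹' {γ ϑ}) :=
    (isClosed_singleton.preimage (hψ.continuous_loop hγ)).isCompact
  have hfin := UnitAddCircle.finite_of_injOn_nsmul
    (by simpa using Nat.pow_le_pow_right two_pos hl) hcpt hmaps hinj
  refine ⟨hfin, ?_⟩
  obtain ⟨m, hm, hmΘ⟩ := hfin.exists_iterate_eq_self hmaps hinj
  refine ⟨l * m, Nat.mul_pos hl hm, fun θ hθ => ?_⟩
  have h1 : (fun θ : UnitAddCircle => 2 ^ l • θ) = angleDoubling^[l] :=
    funext fun θ => (hiter l θ).symm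
  have h2 := hmΘ θ hθ
  rwa [h1, ← Function.iterate_mul, hiter] at h2

end CaratheodoryLoop

/-! ### Fatou components -/

theorem disjoint_connectedComponentIn_of_ne {X : Type*} [TopologicalSpace X] {F : Set X} {x y : X}
    (h : connectedComponentIn F x ≠ connectedComponentIn F y) :
    Disjoint (connectedComponentIn F x) (connectedComponentIn F y) := by
  rw [Set.disjoint_left]
  intro z hx hy
  exact h ((connectedComponentIn_eq hx).trans (connectedComponentIn_eq hy).symm)

theorem closure_connectedComponentIn_inter_subset {X : Type*} [TopologicalSpace X]
    [LocallyConnectedSpace X] {F : Set X} (hF : IsOpen F) (x : X) :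
    closure (connectedComponentIn F x) ∩ F ⊆ connectedComponentIn F x := by
  rintro y ⟨hy, hyF⟩
  obtain ⟨z, hz1, hz2⟩ := mem_closure_iff.1 hy _ hF.connectedComponentIn
    (mem_connectedComponentIn hyF)
  rw [connectedComponentIn_eq hz2, ← connectedComponentIn_eq hz1]
  exact mem_connectedComponentIn hyF

theorem isPreconnected_ball_diff_center (p : ℂ) {r : ℝ} (hr : 0 < r) :
    IsPreconnected (Metric.ball p r \ {p}) := by
  have h1 : IsPreconnected {z : ℂ | z.re < Real.log r} :=
    (convex_halfSpace_re_lt _).isPreconnected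
  have h2 := h1.image (fun z => p + Complex.exp z) (by fun_prop)
  convert h2 using 1
  ext w
  simp only [Set.mem_sdiff, Metric.mem_ball, mem_singleton_iff, mem_image, mem_ofPred_eq,
    dist_eq_norm]
  constructor
  · rintro ⟨hw, hne⟩
    have h0 : w - p ≠ 0 := sub_ne_zero.2 hne
    refine ⟨Complex.log (w - p), ?_, by rw [Complex.exp_log h0]; ring⟩
    rw [Complex.log_re]
    exact Real.log_lt_log (norm_pos_iff.2 h0) hw
  · rintro ⟨z, hz, rfl⟩
    simp only [add_sub_cancel_left, Complex.norm_exp, add_eq_left, Complex.exp_ne_zero,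
      not_false_iff, and_true]
    exact (Real.lt_log_iff_exp_lt hr).1 hz

section FatouComponents

variable {c : ℂ}

theorem fatouSet_eq (c : ℂ) : fatouSet c = insert OnePoint.infty
    ((fun z : ℂ => (z : OnePoint ℂ)) '' (filledJulia c)ᶜ) ∪
      (fun z : ℂ => (z : OnePoint ℂ)) '' interior (filledJulia c) := by
  ext x
  induction x using OnePoint.rec with
  | infty => simp [fatouSet]
  | coe z =>
    simp only [fatouSet, mem_compl_iff, mem_image, OnePoint.coe_eq_coe, exists_eq_right,
      mem_juliaSet_iff, mem_union, mem_insert_iff, OnePoint.coe_ne_infty, false_or]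
    have := @interior_subset _ _ (filledJulia c) z
    tauto

theorem spherePoly_iterate_coe (n : ℕ) (z : ℂ) :
    (spherePoly c)^[n] (z : OnePoint ℂ) = ((quadPoly c)^[n] z : ℂ) := by
  induction n with
  | zero => rfl
  | succ n ih =>
    rw [Function.iterate_succ_apply', Function.iterate_succ_apply', ih]
    rfl

theorem IsBoettcherParam.isPreconnected_compl {ψ : ℂ → ℂ} (hψ : IsBoettcherParam c ψ) :
    IsPreconnected (filledJulia c)ᶜ := by
  rw [← hψ.bijOn.image_eq]
  refine IsPreconnected.image ?_ _ hψ.differentiableOn.continuousOn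
  have h1 : IsPreconnected {z : ℂ | 0 < z.re} := (convex_halfSpace_re_gt _).isPreconnected
  convert h1.image Complex.exp (by fun_prop) using 1
  ext w
  simp only [mem_ofPred_eq, mem_image]
  constructor
  · intro hw
    refine ⟨Complex.log w, ?_, Complex.exp_log (norm_pos_iff.1 (one_pos.trans hw))⟩
    rw [Complex.log_re]
    exact Real.log_pos hw
  · rintro ⟨z, hz, rfl⟩
    simpa [Complex.norm_exp] using hz

theorem isPreconnected_basin_infty (h : IsPreconnected (filledJulia c)ᶜ) :
    IsPreconnected (insert OnePoint.infty
      ((fun z : ℂ => (z : OnePoint ℂ)) '' (filledJulia c)ᶜ)) := by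
  refine (h.image _ OnePoint.continuous_coe.continuousOn).subset_closure (subset_insert _ _)
    (insert_subset ?_ subset_closure)
  refine mem_closure_of_tendsto (OnePoint.tendsto_coe_infty (X := ℂ)) ?_
  rw [coclosedCompact_eq_cocompact]
  filter_upwards [(isCompact_filledJulia c).compl_mem_cocompact] with z hz using ⟨z, hz, rfl⟩

theorem isPeriodicSet_basin_infty (c : ℂ) :
    IsPeriodicSet c (insert OnePoint.infty
      ((fun z : ℂ => (z : OnePoint ℂ)) '' (filledJulia c)ᶜ)) := by
  refine ⟨1, one_pos, ?_⟩
  rw [Function.iterate_one, image_insert_eq]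
  change insert OnePoint.infty _ = _
  congr 1
  rw [image_image]
  ext x
  constructor
  · rintro ⟨z, hz, rfl⟩
    exact ⟨quadPoly c z, fun h => hz (quadPoly_mem_filledJulia_iff.1 h), rfl⟩
  · rintro ⟨w, hw, rfl⟩
    obtain ⟨z, rfl⟩ := quadPoly_surjective c w
    exact ⟨z, fun h => hw (quadPoly_mem_filledJulia_iff.2 h), rfl⟩

/-- A nonperiodic Fatou component is a connected component of the interior of `K_c`. -/
theorem IsFatouComponent.exists_eq_image (hK : IsPreconnected (filledJulia c)ᶜ)
    {U : Set (OnePoint ℂ)} (hU : IsFatouComponent c U) (hper : ¬ IsPeriodicSet c U) :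
    ∃ z ∈ interior (filledJulia c), U = (fun z : ℂ => (z : OnePoint ℂ)) ''
      connectedComponentIn (interior (filledJulia c)) z := by
  obtain ⟨x, hx, rfl⟩ := hU
  set W : Set (OnePoint ℂ) := insert OnePoint.infty
    ((fun z : ℂ => (z : OnePoint ℂ)) '' (filledJulia c)ᶜ) with hW
  set I : Set (OnePoint ℂ) := (fun z : ℂ => (z : OnePoint ℂ)) '' interior (filledJulia c) with hI
  have hWI : Disjoint W I := by
    rw [Set.disjoint_left]
    rintro _ (rfl | ⟨z, hz, rfl⟩) ⟨w, hw, h⟩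
    · exact OnePoint.coe_ne_infty _ h
    · rw [OnePoint.coe_injective h] at hw
      exact hz (interior_subset hw)
  have hWo : IsOpen W := by
    rw [hW, insert_eq, union_comm, ← OnePoint.compl_image_coe]
    exact OnePoint.isOpen_compl_image_coe.2 ⟨isClosed_filledJulia c, isCompact_filledJulia c⟩
  have hIo : IsOpen I := OnePoint.isOpen_image_coe.2 isOpen_interior
  have hF : fatouSet c = W ∪ I := fatouSet_eq c
  have hxI : x ∈ I := by
    by_contra hxI
    have hxW : x ∈ W := by
      rw [hF] at hx
      exact hx.resolve_right hxI
    refine hper ?_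
    convert isPeriodicSet_basin_infty c using 1
    apply Subset.antisymm
    · exact isPreconnected_connectedComponentIn.subset_left_of_subset_union hWo hIo hWI
        (hF ▸ connectedComponentIn_subset _ _) ⟨x, mem_connectedComponentIn hx, hxW⟩
    · exact (isPreconnected_basin_infty hK).subset_connectedComponentIn hxW
        (hF ▸ subset_union_left)
  obtain ⟨z, hz, rfl⟩ := hxI
  refine ⟨z, hz, ?_⟩
  have hsub : connectedComponentIn (fatouSet c) (z : OnePoint ℂ) ⊆ I :=
    isPreconnected_connectedComponentIn.subset_left_of_subset_union hIo hWo hWI.symm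
      (union_comm W I ▸ hF ▸ connectedComponentIn_subset _ _)
      ⟨_, mem_connectedComponentIn hx, ⟨z, hz, rfl⟩⟩
  apply Subset.antisymm
  · intro y hy
    obtain ⟨w, hw, rfl⟩ := hsub hy
    refine ⟨w, ?_, rfl⟩
    have hpre : IsPreconnected ((fun z : ℂ => (z : OnePoint ℂ)) ⁻¹'
        connectedComponentIn (fatouSet c) (z : OnePoint ℂ)) :=
      isPreconnected_connectedComponentIn.preimage_of_isOpenMap OnePoint.coe_injective
        OnePoint.isOpenMap_coe (hsub.trans (image_subset_range _ _))
    refine hpre.subset_connectedComponentIn (mem_connectedComponentIn hx) ?_ hy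
    intro a ha
    obtain ⟨b, hb, h⟩ := hsub ha
    rwa [← OnePoint.coe_injective h]
  · refine (isPreconnected_connectedComponentIn.image _
      OnePoint.continuous_coe.continuousOn).subset_connectedComponentIn
      ⟨z, mem_connectedComponentIn hz, rfl⟩ ?_
    exact (image_mono (connectedComponentIn_subset _ _)).trans (hF ▸ subset_union_right)

theorem iterate_mem_interior_iff (n : ℕ) {z : ℂ} :
    (quadPoly c)^[n] z ∈ interior (filledJulia c) ↔ z ∈ interior (filledJulia c) := by
  induction n with
  | zero => rfl
  | succ n ih => rw [Function.iterate_succ_apply', quadPoly_mem_interior_iff, ih]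

theorem isOpenMap_iterate (c : ℂ) (n : ℕ) : IsOpenMap (quadPoly c)^[n] := by
  induction n with
  | zero => exact IsOpenMap.id
  | succ n ih => exact ih.comp (isOpenMap_quadPoly c)

/-- The image of the component is open, and relatively closed in the target component: by
compactness limit points come from the closure, and a preimage of an interior point of `K_c` is
again interior, hence in the component itself. -/
theorem image_iterate_connectedComponentIn (n : ℕ) {z : ℂ} (hz : z ∈ interior (filledJulia c)) :
    (quadPoly c)^[n] '' connectedComponentIn (interior (filledJulia c)) z =
      connectedComponentIn (interior (filledJulia c)) ((quadPoly c)^[n] z) := by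
  have hcont : Continuous (quadPoly c)^[n] := (continuous_quadPoly c).iterate n
  set C := connectedComponentIn (interior (filledJulia c)) z with hC
  have hCK : C ⊆ filledJulia c := (connectedComponentIn_subset _ _).trans interior_subset
  have hzC : z ∈ C := mem_connectedComponentIn hz
  apply Subset.antisymm
  · refine (isPreconnected_connectedComponentIn.image _
      hcont.continuousOn).subset_connectedComponentIn ⟨z, hzC, rfl⟩ ?_
    rintro _ ⟨w, hw, rfl⟩
    exact (iterate_mem_interior_iff n).2 (connectedComponentIn_subset _ _ hw)
  · refine isPreconnected_connectedComponentIn.subset_of_closure_inter_subset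
      (isOpenMap_iterate c n _ isOpen_interior.connectedComponentIn)
      ⟨_, mem_connectedComponentIn ((iterate_mem_interior_iff n).2 hz), ⟨z, hzC, rfl⟩⟩ ?_
    rintro y ⟨hy, hyC⟩
    have hcpt : IsCompact (closure C) :=
      ((isBounded_filledJulia c).subset hCK).isCompact_closure
    obtain ⟨w, hw, rfl⟩ := closure_minimal (image_mono subset_closure)
      (hcpt.image hcont).isClosed hy
    exact ⟨w, closure_connectedComponentIn_inter_subset isOpen_interior z
      ⟨hw, (iterate_mem_interior_iff n).1 (connectedComponentIn_subset _ _ hyC)⟩, rfl⟩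

theorem frontier_connectedComponentIn_subset_juliaSet (z : ℂ) :
    frontier (connectedComponentIn (interior (filledJulia c)) z) ⊆ juliaSet c := by
  intro x hx
  refine mem_juliaSet_iff.2 ⟨?_, fun hxi => ?_⟩
  · exact closure_minimal ((connectedComponentIn_subset _ _).trans interior_subset)
      (isClosed_filledJulia c) (frontier_subset_closure hx)
  · rw [isOpen_interior.connectedComponentIn.frontier_eq] at hx
    exact hx.2 (closure_connectedComponentIn_inter_subset isOpen_interior z ⟨hx.1, hxi⟩)

/-- The boundary of a component of the interior of `K_c` has no isolated points. -/
theorem exists_mem_frontier_connectedComponentIn_ne {z p : ℂ} (hp : p ∈ juliaSet c)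
    (hpC : p ∈ closure (connectedComponentIn (interior (filledJulia c)) z))
    {s : Set ℂ} (hs : s ∈ 𝓝 p) :
    ∃ x ∈ frontier (connectedComponentIn (interior (filledJulia c)) z), x ∈ s ∧ x ≠ p := by
  set C := connectedComponentIn (interior (filledJulia c)) z with hC
  have hCo : IsOpen C := isOpen_interior.connectedComponentIn
  have hpn : p ∉ C := fun h => (mem_juliaSet_iff.1 hp).2 (connectedComponentIn_subset _ _ h)
  obtain ⟨r, hr, hrs⟩ := Metric.mem_nhds_iff.1 hs
  by_contra! hno
  -- Without other frontier points nearby, the connected punctured disc lies in `C`, so `p` would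
  -- not be a limit of points outside `K_c`.
  have hsub : Metric.ball p r \ {p} ⊆ C := by
    refine (isPreconnected_ball_diff_center p hr).subset_of_closure_inter_subset hCo ?_ ?_
    · obtain ⟨y, hy1, hy2⟩ := mem_closure_iff.1 hpC _ Metric.isOpen_ball (Metric.mem_ball_self hr)
      exact ⟨y, ⟨hy1, fun e => hpn (e ▸ hy2)⟩, hy2⟩
    · rintro y ⟨hy1, hy2, hy3⟩
      by_contra hyC
      exact hy3 (hno y (hCo.frontier_eq ▸ ⟨hy1, hyC⟩) (hrs hy2))
  rw [juliaSet, frontier_eq_closure_inter_closure] at hp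
  obtain ⟨y, hy1, hy2⟩ := mem_closure_iff.1 hp.2 _ Metric.isOpen_ball (Metric.mem_ball_self hr)
  by_cases hyp : y = p
  · exact hy2 (hyp ▸ (isClosed_filledJulia c).closure_subset hp.1)
  · exact hy2 (interior_subset (connectedComponentIn_subset _ _ (hsub ⟨hy1, hyp⟩)))

end FatouComponents

/-- Near a point whose fibre under `γ` is finite, points of `range γ` other than that point are
values of `γ` at angles `θ + t` with `θ` in the fibre and `t` small. -/
theorem eventually_exists_near_fiber {γ : UnitAddCircle → ℂ} (hγ : Continuous γ) (p : ℂ) {ε : ℝ}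
    (hε : 0 < ε) : ∀ᶠ x in 𝓝 p, x ≠ p → x ∈ range γ →
      ∃ θ, γ θ = p ∧ ∃ t : ℝ, t ≠ 0 ∧ |t| < ε ∧ γ (θ + (t : UnitAddCircle)) = x := by
  have hO : IsOpen (⋃ θ ∈ γ ⁻¹' {p}, Metric.ball θ ε) :=
    isOpen_biUnion fun _ _ => Metric.isOpen_ball
  have hcl : IsClosed (γ '' (⋃ θ ∈ γ ⁻¹' {p}, Metric.ball θ ε)ᶜ) :=
    (hO.isClosed_compl.isCompact.image hγ).isClosed
  have hp : p ∉ γ '' (⋃ θ ∈ γ ⁻¹' {p}, Metric.ball θ ε)ᶜ := by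
    rintro ⟨θ, hθ, h⟩
    exact hθ (mem_biUnion (x := θ) h (Metric.mem_ball_self hε))
  filter_upwards [hcl.isOpen_compl.mem_nhds hp] with x hx hxp hxγ
  obtain ⟨α, rfl⟩ := hxγ
  have hα : α ∈ ⋃ θ ∈ γ ⁻¹' {p}, Metric.ball θ ε := by
    by_contra h
    exact hx ⟨α, h, rfl⟩
  simp only [mem_iUnion, Metric.mem_ball, dist_eq_norm, exists_prop] at hα
  obtain ⟨θ, hθ, hαθ⟩ := hα
  obtain ⟨t, ht, htn⟩ := UnitAddCircle.exists_real_norm_eq (α - θ)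
  have hγt : θ + (t : UnitAddCircle) = α := by rw [ht]; abel
  refine ⟨θ, hθ, t, ?_, htn ▸ hαθ, by rw [hγt]⟩
  rintro rfl
  rw [AddCircle.coe_zero, add_zero] at hγt
  exact hxp (hγt ▸ hθ)

/-! ### The contradiction at a periodic landing point -/

theorem lemmal (c : ℂ) (hconn : IsConnected (filledJulia c))
    (hloc : LocallyConnectedSpace (juliaSet c))
    (γ : UnitAddCircle → ℂ) (hγ : IsCaratheodoryLoop c γ)
    (ϑ : UnitAddCircle) (hϑ : ϑ ∈ Function.periodicPts angleDoubling)
    (U : Set (OnePoint ℂ)) (hU : IsStrictlyPreperiodicFatouComponent c U) :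
    ((γ ϑ : ℂ) : OnePoint ℂ) ∉ frontier U := by
  intro hfr
  obtain ⟨ψ, hψ, hlim⟩ := hγ
  obtain ⟨hUF, hUper, -⟩ := hU
  obtain ⟨z, hz, rfl⟩ := hUF.exists_eq_image hψ.isPreconnected_compl hUper
  obtain ⟨hfin, N, hN, hfix⟩ := hψ.exists_fixing_iterate hlim hϑ
  have hγc := hψ.continuous_loop hlim
  have hγJ : ∀ θ, γ θ ∈ juliaSet c := fun θ => hψ.range_loop hlim ▸ mem_range_self θ
  set p : ℂ := γ ϑ with hp
  have hpJ : p ∈ juliaSet c := hγJ ϑ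
  set C : Set ℂ := connectedComponentIn (interior (filledJulia c)) z with hC
  have hCI : C ⊆ interior (filledJulia c) := connectedComponentIn_subset _ _
  have hf : Continuous (quadPoly c)^[N] := (continuous_quadPoly c).iterate N
  have hpf : (quadPoly c)^[N] p = p := by
    rw [hp, ← hψ.loop_two_pow_nsmul hlim, hfix ϑ rfl]
  have hpC : p ∈ closure C := by
    have h := frontier_subset_closure hfr
    rw [OnePoint.isOpenEmbedding_coe.isInducing.closure_eq_preimage_closure_image]
    exact h
  set V : Set ℂ := connectedComponentIn (interior (filledJulia c)) ((quadPoly c)^[N] z) with hV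
  have hVI : V ⊆ interior (filledJulia c) := connectedComponentIn_subset _ _
  have hCV : (quadPoly c)^[N] '' C = V := image_iterate_connectedComponentIn N hz
  have hclV : ∀ x ∈ closure C, (quadPoly c)^[N] x ∈ closure V := fun x hx =>
    hCV ▸ image_closure_subset_closure_image hf ⟨x, hx, rfl⟩
  have hne : C ≠ V := by
    intro hCV'
    refine hUper ⟨N, hN, ?_⟩
    rw [image_image]
    simp only [spherePoly_iterate_coe]
    rw [← image_image (fun z : ℂ => (z : OnePoint ℂ)), hCV, ← hCV']
  have hzC : z ∈ C := mem_connectedComponentIn hz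
  have hfz : (quadPoly c)^[N] z ∈ V := mem_connectedComponentIn ((iterate_mem_interior_iff N).2 hz)
  obtain ⟨ε₀, hε₀, hsep⟩ : ∃ ε > 0, ∀ θ θ', γ θ = p → γ θ' = p → dist θ θ' < ε → θ = θ' := by
    obtain ⟨e, he, h⟩ := hfin.relatively_discrete
    obtain ⟨ε, hε, hεe⟩ := ENNReal.lt_iff_exists_nnreal_btwn.1 he
    refine ⟨ε, by exact_mod_cast hε, fun θ θ' hθ hθ' hd => ?_⟩
    by_contra hne
    have h1 := hεe.trans_le (h θ hθ θ' hθ' hne)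
    rw [edist_nndist, ENNReal.coe_lt_coe, ← NNReal.coe_lt_coe, coe_nndist] at h1
    exact lt_asymm hd h1
  have hD : (0 : ℝ) < 2 ^ N := by positivity
  -- Dividing by `2 ^ N` keeps all `s * t` with `s ≤ 2 ^ N` small: below `1 / 2`, so the circle norm
  -- is `|s * t|`, and below `ε₀`, so `θ + s * t` meets no other angle of the fibre.
  obtain ⟨x, hxC, hxnear, hxp⟩ := exists_mem_frontier_connectedComponentIn_ne hpJ hpC
    (eventually_exists_near_fiber hγc p (ε := min ε₀ (1 / 2) / 2 ^ N) (by positivity))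
  have hxJ : x ∈ juliaSet c := frontier_connectedComponentIn_subset_juliaSet z hxC
  obtain ⟨θ, hθ, t, ht0, htε, hγx⟩ := hxnear hxp ((hψ.range_loop hlim).symm ▸ hxJ)
  rw [lt_div_iff₀ hD] at htε
  set σ : ℝ → UnitAddCircle := fun s => θ + ((s * t : ℝ) : UnitAddCircle) with hσ
  have hσc : Continuous σ := by
    have : Continuous fun r : ℝ => (r : UnitAddCircle) := AddCircle.continuous_mk' 1
    fun_prop
  set L : Set ℂ := γ '' (σ '' Icc 1 (2 ^ N)) with hL
  have hLpre : IsPreconnected L :=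
    (isPreconnected_Icc.image _ hσc.continuousOn).image _ hγc.continuousOn
  have hLJ : L ⊆ juliaSet c := by
    rintro _ ⟨α, -, rfl⟩
    exact hγJ α
  have hpL : p ∉ L := by
    rintro ⟨_, ⟨s, ⟨hs1, hs2⟩, rfl⟩, hs⟩
    have hst : |s * t| < min ε₀ (1 / 2) := by
      rw [abs_mul, abs_of_pos (one_pos.trans_le hs1), mul_comm]
      exact (mul_le_mul_of_nonneg_left hs2 (abs_nonneg t)).trans_lt htε
    have hnorm : ‖((s * t : ℝ) : UnitAddCircle)‖ = |s * t| :=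
      UnitAddCircle.norm_coe_of_abs_le (hst.trans_le (min_le_right _ _)).le
    have h1 : σ s = θ := hsep _ _ hs hθ (by
      rw [dist_eq_norm, hσ, add_sub_cancel_left, hnorm]
      exact hst.trans_le (min_le_left _ _))
    have h2 : ((s * t : ℝ) : UnitAddCircle) = 0 := by simpa [hσ] using h1
    rw [h2, norm_zero, eq_comm, abs_eq_zero, mul_eq_zero] at hnorm
    rcases hnorm with h | h
    · linarith
    · exact ht0 h
  have hone : (1 : ℝ) ≤ 2 ^ N := one_le_pow₀ one_le_two
  have hLC : (L ∩ closure C).Nonempty := by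
    refine ⟨x, ⟨σ 1, ⟨1, ⟨le_rfl, hone⟩, rfl⟩, ?_⟩, frontier_subset_closure hxC⟩
    simpa [hσ] using hγx
  have hLV : (L ∩ closure V).Nonempty := by
    refine ⟨(quadPoly c)^[N] x, ⟨σ (2 ^ N), ⟨2 ^ N, ⟨hone, le_rfl⟩, rfl⟩, ?_⟩,
      hclV x (frontier_subset_closure hxC)⟩
    -- Since `2 ^ N` fixes `θ`, the far end `s = 2 ^ N` of the arc is the image of its near end `x`.
    rw [← hγx, ← hψ.loop_two_pow_nsmul hlim, nsmul_add, hfix θ hθ, ← AddCircle.coe_nsmul,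
      nsmul_eq_mul]
    simp [hσ]
  obtain ⟨h, hh⟩ := hψ.exists_log_of_touching hlim isPreconnected_connectedComponentIn
    isPreconnected_connectedComponentIn hLpre hCI hVI hLJ hpJ hpC (hpf ▸ hclV p hpC) hLC hLV hpL
    hzC hfz
  exact not_exists_log_of_separated (isCompact_juliaSet c)
    ((isBounded_filledJulia c).subset (hCI.trans interior_subset))
    (frontier_connectedComponentIn_subset_juliaSet z) hzC
    (Set.disjoint_right.1 (disjoint_connectedComponentIn_of_ne hne) hfz)
    (fun hJ => (mem_juliaSet_iff.1 hJ).2 (hVI hfz)) h hh
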